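/- Let $n\ge1$ and let $K\colon\mathbb R^n\to[0,+\infty]$ be a measurable function, not a.e. equal to $0$, such that: - (Rad) $K(x)=\kappa(|x|)$ for all $x\in\mathbb R^n$, for some measurable $\kappa\colon[0,+\infty)\to[0,+\infty]$; - (Nts) $\int_{\mathbb R^n}\min\{1,|x|\}\,K(x)\,dx<+\infty$; - (Nint) $K\notin L^1(\mathbb R^n)$; - (Dec$_q$) for some $q\in[1,n+1)$, $K(y)|y|^q\le K(x)|x|^q$ whenever $0<|x|\le|y|$; - (Dou) there is $C>0$ such that $K(x)\le C\,K(y)$ whenever $|y|=2|x|$. Let $\nu=w\mathscr L^n$ with $w\in L^\infty(\mathbb R^n)$ and $\operatorname{ess\,inf}w>0$. For $u\in L^1_{\rm loc}(\mathbb R^n)$ let $$[u]_K=\tfrac12\int_{\mathbb R^n}\int_{\mathbb R^n}|u(x)-u(y)|\,K(x-y)\,dx\,dy\in[0,+\infty],$$ let $P_K(U)=[\chi_U]_K$ for Lebesgue measurable $U\subset\mathbb R^n$, and let $BV^K(\mathbb R^n;[0,1])$ be the set of $u\in L^1(\mathbb R^n)$ with $[u]_K<+\infty$ and $0\le u\le1$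 a.e. For a measurable set $E$ let $$h_{K,\nu}(E)=\inf\Big\{\frac{P_K(F)}{\nu(F)} : F\subset E\text{ measurable},\ 0<|F|<+\infty\Big\},$$ and let $\mathcal C_{K,\nu}(E)$ be the family of the sets $F$ attaining this infimum ($(K,\nu)$-Cheeger sets of $E$). The set $E$ is $(K,\nu)$-calibrable if it contains a measurable set $F$ with $0<|F|<+\infty$ and $P_K(F)<+\infty$, and $E\in\mathcal C_{K,\nu}(E)$. For $\Lambda>0$, let $\mathrm{GSol}(E,\Lambda,\nu)$ be the family of the measurable sets $U$ which minimize $P_K(U)+\Lambda\,\nu(E\bigtriangleup U)$ among all measurable sets, with finite minimum, and let $\mathrm{Sol}(\chi_E,\Lambda,\nu)$ be the set of the functions $u$ which minimize $[u]_K+\Lambda\int_{\mathbb R^n}|u-\chi_E|\,d\nu$ among all $u\in L^1_{\rm loc}(\mathbb R^n)$, with finite minimum. Sets and functions are identified when they agree up to Lebesgue-null sets. **Theorem (Relation with fidelity).** If $E\subset\mathbb R^n$ is bounded and convex with non-empty interior, then: 1. $h_{K,\nu}(E)=\sup\{\Lambda>0:\emptyset\in\mathrm{GSol}(E,\Lambda,\nu)\}\in(0,+\infty)$;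 2. if $0<\Lambda<h_{K,\nu}(E)$, then $\mathrm{GSol}(E,\Lambda,\nu)=\{\emptyset\}$; 3. if $\Lambda=h_{K,\nu}(E)$, then $\mathrm{GSol}(E,\Lambda,\nu)=\mathcal C_{K,\nu}(E)\cup\{\emptyset\}$ and $$\mathrm{Sol}(\chi_E,\Lambda,\nu)=\big\{u\in BV^K(\mathbb R^n;[0,1]):\{u>t\}\in\mathcal C_{K,\nu}(E)\cup\{\emptyset\}\text{ for all }t\in[0,1)\big\};$$ 4. if $\Lambda>h_{K,\nu}(E)$ and $E$ is $(K,\nu)$-calibrable, then $\mathrm{GSol}(E,\Lambda,\nu)=\{E\}$. -/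

import Mathlib

open MeasureTheory Set
open scoped ENNReal NNReal symmDiff

namespace NonlocalBV

/-- The Euclidean space of dimension `n`. -/
abbrev Rn (n : ℕ) : Type := EuclideanSpace ℝ (Fin n)

variable {n : ℕ}

/-! ### Kernels and their properties -/

/-- A kernel: a measurable function with values in `[0, +∞]`, not a.e. equal to zero. -/
def IsKernel (K : Rn n → ℝ≥0∞) : Prop :=
  Measurable K ∧ ¬ (K =ᵐ[volume] 0)

/-- (Rad): `K x = κ |x|` for a measurable profile `κ : [0, +∞) → [0, +∞]`. -/
def Radial (K : Rn n → ℝ≥0∞) : Prop :=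
  ∃ κ : ℝ≥0 → ℝ≥0∞, Measurable κ ∧ ∀ x, K x = κ ‖x‖₊

/-- (Nts): `∫ (1 ∧ |x|) K(x) dx < +∞`. -/
def NotTooSingular (K : Rn n → ℝ≥0∞) : Prop :=
  ∫⁻ x, ENNReal.ofReal (min 1 ‖x‖) * K x < ∞

/-- (Nint): `K` is not integrable. -/
def NotIntegrable (K : Rn n → ℝ≥0∞) : Prop :=
  ∫⁻ x, K x = ∞

/-- (Dec_q): `x ↦ K(x)|x|^q` is radially decreasing away from the origin.
The point `x = 0`, where the product `K(0)|0|^q` is not meaningful, is left out. -/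
def DecreasingExp (q : ℝ) (K : Rn n → ℝ≥0∞) : Prop :=
  ∀ x y : Rn n, 0 < ‖x‖ → ‖x‖ ≤ ‖y‖ →
    K y * ENNReal.ofReal (‖y‖ ^ q) ≤ K x * ENNReal.ofReal (‖x‖ ^ q)

/-- (Dou_D): the (local) doubling property of radius `D ∈ (0, +∞]`. -/
def Doubling (D : ℝ≥0∞) (K : Rn n → ℝ≥0∞) : Prop :=
  ∃ C : ℝ≥0, 0 < C ∧ ∀ x y : Rn n, ‖y‖ = 2 * ‖x‖ → ENNReal.ofReal ‖x‖ ≤ 2 * D →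
    K x ≤ C * K y

/-- Admissible weight measures: `ν = w ℒⁿ` with `w ∈ L^∞` and `ess inf w > 0`. -/
def AdmissibleWeight (ν : Measure (Rn n)) : Prop :=
  ∃ w : Rn n → ℝ≥0∞, AEMeasurable w volume ∧ essSup w volume < ∞ ∧
    0 < essInf w volume ∧ ν = volume.withDensity w

/-! ### Variation and perimeter -/

/-- The `K`-variation `[u]_K = 1/2 ∫∫ |u(x) - u(y)| K(x - y) dx dy`. -/
noncomputable def variation (K : Rn n → ℝ≥0∞) (u : Rn n → ℝ) : ℝ≥0∞ :=
  2⁻¹ * ∫⁻ y, ∫⁻ x, ENNReal.ofReal |u x - u y| * K (x - y)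

/-- The characteristic function of a set. -/
noncomputable def chi (E : Set (Rn n)) : Rn n → ℝ :=
  E.indicator 1

/-- The `K`-perimeter `P_K(E) = [χ_E]_K`. -/
noncomputable def perimeter (K : Rn n → ℝ≥0∞) (E : Set (Rn n)) : ℝ≥0∞ :=
  variation K (chi E)

/-! ### Cheeger constant and Cheeger sets

`NullMeasurableSet E volume` says that `E` is Lebesgue measurable. -/

/-- `Ω` contains a measurable set of positive finite measure and finite `K`-perimeter. -/
def KAdmissible (K : Rn n → ℝ≥0∞) (Ω : Set (Rn n)) : Prop :=
  NullMeasurableSet Ω volume ∧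
    ∃ F : Set (Rn n), NullMeasurableSet F volume ∧ F ⊆ Ω ∧
      0 < volume F ∧ volume F < ∞ ∧ perimeter K F < ∞

/-- The competitors in the Cheeger problem of `Ω`. -/
def cheegerCompetitors (Ω : Set (Rn n)) : Set (Set (Rn n)) :=
  {F | NullMeasurableSet F volume ∧ F ⊆ Ω ∧ 0 < volume F ∧ volume F < ∞}

/-- The `(K, ν)`-Cheeger constant `h_{K,ν}(Ω)`. -/
noncomputable def cheegerConst (K : Rn n → ℝ≥0∞) (ν : Measure (Rn n)) (Ω : Set (Rn n)) :
    ℝ≥0∞ :=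
  sInf ((fun F => perimeter K F / ν F) '' cheegerCompetitors Ω)

/-- The `(K, ν)`-Cheeger sets of `Ω`: the minimizers in the definition of `h_{K,ν}(Ω)`. -/
def cheegerSets (K : Rn n → ℝ≥0∞) (ν : Measure (Rn n)) (Ω : Set (Rn n)) :
    Set (Set (Rn n)) :=
  {F | F ∈ cheegerCompetitors Ω ∧ perimeter K F / ν F = cheegerConst K ν Ω}

/-- `Ω` is `(K, ν)`-calibrable: it is `K`-admissible and a Cheeger set of itself. -/
def Calibrable (K : Rn n → ℝ≥0∞) (ν : Measure (Rn n)) (Ω : Set (Rn n)) : Prop :=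
  KAdmissible K Ω ∧ Ω ∈ cheegerSets K ν Ω

/-! ### The functional and the geometric problem -/

/-- The functional energy `[u]_K + Λ ∫ |u - f| dν`. -/
noncomputable def functionalEnergy (K : Rn n → ℝ≥0∞) (ν : Measure (Rn n)) (f : Rn n → ℝ)
    (Λ : ℝ≥0) (u : Rn n → ℝ) : ℝ≥0∞ :=
  variation K u + Λ * ∫⁻ x, ENNReal.ofReal |u x - f x| ∂ν

/-- Solutions of the functional problem: minimizers over `L¹_loc` with finite energy. -/
def functionalSol (K : Rn n → ℝ≥0∞) (ν : Measure (Rn n)) (f : Rn n → ℝ) (Λ : ℝ≥0) :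
    Set (Rn n → ℝ) :=
  {u | LocallyIntegrable u volume ∧ functionalEnergy K ν f Λ u < ∞ ∧
    ∀ v : Rn n → ℝ, LocallyIntegrable v volume →
      functionalEnergy K ν f Λ u ≤ functionalEnergy K ν f Λ v}

/-- The geometric energy `P_K(U) + Λ ν(E ∆ U)`. -/
noncomputable def geometricEnergy (K : Rn n → ℝ≥0∞) (ν : Measure (Rn n)) (E : Set (Rn n))
    (Λ : ℝ≥0) (U : Set (Rn n)) : ℝ≥0∞ :=
  perimeter K U + Λ * ν (E ∆ U)

/-- Solutions of the geometric problem: minimizers over measurable sets with finite energy. -/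
def geometricSol (K : Rn n → ℝ≥0∞) (ν : Measure (Rn n)) (E : Set (Rn n)) (Λ : ℝ≥0) :
    Set (Set (Rn n)) :=
  {U | NullMeasurableSet U volume ∧ geometricEnergy K ν E Λ U < ∞ ∧
    ∀ V : Set (Rn n), NullMeasurableSet V volume →
      geometricEnergy K ν E Λ U ≤ geometricEnergy K ν E Λ V}

/-- All the sets that agree with some member of `𝒮` up to a Lebesgue-null set. As always for
Lebesgue measurable sets, families of sets are compared up to null sets. -/
def upToNull (𝒮 : Set (Set (Rn n))) : Set (Set (Rn n)) :=
  {U | ∃ V ∈ 𝒮, U =ᵐ[volume] V}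

/-- The space `BV^K(ℝⁿ; [0,1])`. -/
def BVUnit (K : Rn n → ℝ≥0∞) : Set (Rn n → ℝ) :=
  {u | Integrable u volume ∧ variation K u < ∞ ∧ ∀ᵐ x ∂volume, u x ∈ Icc (0 : ℝ) 1}

end NonlocalBV

open NonlocalBV

namespace NonlocalBV
variable {n : ℕ}

/-! Everything rests on one inequality: cutting a set of finite measure by a convex set does not
increase its `K`-perimeter (`perimeter_inter_convex_le`). Hence the geometric energy of `U` is at
least `P_K(U ∩ E) + Λ ν(E \ U) + Λ ν(U \ E)`, and the definition of the Cheeger constant `h` gives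
`P_K(U ∩ E) ≥ h ν(U ∩ E)`.

If `Λ ≤ h`, these bounds give at least `Λ ν(E)`, the energy of `∅`. Equality forces `U ⊆ E` up to a
null set and `P_K(U) ≤ Λ ν(U)`: so `U` is null if `Λ < h`, and null or a Cheeger set if `Λ = h`.
Conversely, if `∅` is a minimizer, comparing it with each `F ⊆ E` gives `Λ ≤ h`. If `Λ > h` and `E`
is calibrable, the lower bound reads `h ν(E) + (Λ - h) ν(E \ U) + Λ ν(U \ E)`, which exceeds the
energy `h ν(E)` of `E` unless `U = E` a.e.

For functions, coarea and the layer-cake formula write the energy as an integral over `t` of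
geometric energies of `{u > t}`. For `t ∈ [0,1)` the datum is `E` and the minimum is `Λ ν(E)`; for
other `t` it is `0`. A minimizer is thus optimal at almost every level, and lower semicontinuity of
the perimeter extends this to every `t ∈ [0,1)`.

Finally `h > 0` because `K` vanishes nowhere off the origin and a bounded set is disjoint from its
far translates; `h < ∞` because balls have finite perimeter by (Nts). -/

theorem variation_congr_ae (K : Rn n → ℝ≥0∞) {u v : Rn n → ℝ} (h : u =ᵐ[volume] v) :
    variation K u = variation K v := by
  unfold variation
  congr 1
  refine lintegral_congr_ae ?_
  filter_upwards [h] with y hy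
  refine lintegral_congr_ae ?_
  filter_upwards [h] with x hx
  rw [hx, hy]

theorem chi_congr_ae {U V : Set (Rn n)} (h : U =ᵐ[volume] V) : chi U =ᵐ[volume] chi V :=
  indicator_ae_eq_of_ae_eq_set h

theorem perimeter_congr_ae (K : Rn n → ℝ≥0∞) {U V : Set (Rn n)} (h : U =ᵐ[volume] V) :
    perimeter K U = perimeter K V :=
  variation_congr_ae K (chi_congr_ae h)

theorem measurable_chi {U : Set (Rn n)} (hU : MeasurableSet U) : Measurable (chi U) :=
  measurable_one.indicator hU

open Classical in
theorem ofReal_abs_chi_sub (U V : Set (Rn n)) (x y : Rn n) :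
    ENNReal.ofReal |chi U x - chi V y| = if (x ∈ U ↔ y ∈ V) then 0 else 1 := by
  unfold chi
  by_cases hx : x ∈ U <;> by_cases hy : y ∈ V <;> simp [hx, hy]

theorem lintegral_abs_chi_sub {ν : Measure (Rn n)} {U V : Set (Rn n)}
    (h : NullMeasurableSet (U ∆ V) ν) :
    ∫⁻ x, ENNReal.ofReal |chi V x - chi U x| ∂ν = ν (U ∆ V) := by
  rw [← lintegral_indicator_one₀ h]
  refine lintegral_congr fun x => ?_
  rw [ofReal_abs_chi_sub]
  by_cases hx : x ∈ U <;> by_cases hy : x ∈ V <;> simp [hx, hy, Set.mem_symmDiff]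

/-! ### Perimeter as an integral over translations; cutting by a convex set. -/

theorem variation_eq_lintegral_translate {K : Rn n → ℝ≥0∞} (hK : Measurable K)
    {u : Rn n → ℝ} (hu : Measurable u) :
    variation K u
      = 2⁻¹ * ∫⁻ z, (∫⁻ y, ENNReal.ofReal |u (y + z) - u y|) * K z := by
  unfold variation
  congr 1
  have h1 : ∀ y, ∫⁻ x, ENNReal.ofReal |u x - u y| * K (x - y)
      = ∫⁻ z, ENNReal.ofReal |u (y + z) - u y| * K z := by
    intro y
    rw [← lintegral_add_left_eq_self _ y]
    simp
  simp_rw [h1]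
  rw [lintegral_lintegral_swap]
  · refine lintegral_congr fun z => ?_
    rw [lintegral_mul_const]
    fun_prop
  · unfold Function.uncurry
    fun_prop

theorem perimeter_eq_lintegral_translate {K : Rn n → ℝ≥0∞} (hK : Measurable K)
    {U : Set (Rn n)} (hU : MeasurableSet U) :
    perimeter K U = 2⁻¹ * ∫⁻ z, volume (U ∆ ((· + z) ⁻¹' U)) * K z := by
  unfold perimeter
  rw [variation_eq_lintegral_translate hK (measurable_chi hU)]
  congr 1
  refine lintegral_congr fun z => ?_
  congr 1
  have hm : MeasurableSet ((· + z) ⁻¹' U) := (measurable_add_const z) hU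
  rw [← lintegral_abs_chi_sub (hU.symmDiff hm).nullMeasurableSet]
  rfl

/-- Under translation by `z`, as much mass leaves `G` as enters it: both sides equal `|G|` minus the
overlap of `G` with its translate. Finiteness makes the subtraction legitimate. -/
theorem measure_diff_translate_neg {G : Set (Rn n)} (hG : MeasurableSet G)
    (hfin : volume G ≠ ∞) (z : Rn n) :
    volume (G \ ((· + z) ⁻¹' G)) = volume (G \ ((· + -z) ⁻¹' G)) := by
  have hm : ∀ z : Rn n, MeasurableSet ((· + z) ⁻¹' G) := fun z => (measurable_add_const z) hG
  have h : ∀ z : Rn n, volume (G \ ((· + z) ⁻¹' G)) = volume G - volume (G ∩ (· + z) ⁻¹' G) := by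
    intro z
    rw [← sdiff_self_inter, measure_sdiff inter_subset_left (hG.inter (hm z)).nullMeasurableSet
      (measure_ne_top_of_subset inter_subset_left hfin)]
  rw [h, h, ← measure_preimage_add_right volume (-z) (G ∩ (· + z) ⁻¹' G)]
  congr 2
  ext x
  simp [and_comm]

theorem measure_symmDiff_translate {G : Set (Rn n)} (hG : MeasurableSet G)
    (hfin : volume G ≠ ∞) (z : Rn n) :
    volume (G ∆ ((· + z) ⁻¹' G)) = 2 * volume (G \ ((· + z) ⁻¹' G)) := by
  have hm : MeasurableSet ((· + z) ⁻¹' G) := (measurable_add_const z) hG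
  rw [measure_symmDiff_eq hG.nullMeasurableSet hm.nullMeasurableSet, two_mul]
  congr 1
  rw [measure_diff_translate_neg hG hfin, ← measure_preimage_add_right volume z (G \ _)]
  congr 1
  ext x
  simp

/-- A point leaving `F ∩ E` under `x ↦ x + z` either leaves `F`, or stays in `F` but leaves `E` (the
set `B`). The latter enter `G`, the part of `F \ E` reached from `E` by positive multiples of `z`.
Entries into `G` balance exits from it, and by convexity an orbit that has left `E` never returns,
so an exit from `G` is an exit from `F` at a point outside `E`. The two kinds of exits from `F` are
therefore disjoint. -/
theorem measure_inter_convex_diff_translate_le {E F : Set (Rn n)} (hE : Convex ℝ E)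
    (hEm : MeasurableSet E) (hF : MeasurableSet F) (hfin : volume F ≠ ∞) (z : Rn n) :
    volume ((F ∩ E) \ ((· + z) ⁻¹' (F ∩ E))) ≤ volume (F \ ((· + z) ⁻¹' F)) := by
  have hm : ∀ z : Rn n, Measurable (fun x : Rn n => x + z) := fun z => measurable_add_const z
  set G : Set (Rn n) := (F \ E) ∩ ⋃ k : ℕ, (· + -((k + 1 : ℝ) • z)) ⁻¹' E with hGdef
  have hGm : MeasurableSet G := (hF.diff hEm).inter (MeasurableSet.iUnion fun k => hm _ hEm)
  have hGF : G ⊆ F := fun x hx => hx.1.1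
  have hGfin : volume G ≠ ∞ := measure_ne_top_of_subset hGF hfin
  set B : Set (Rn n) := (F ∩ E) ∩ (· + z) ⁻¹' (F \ E) with hB
  have h1 : (F ∩ E) \ ((· + z) ⁻¹' (F ∩ E)) ⊆ B ∪ (F \ ((· + z) ⁻¹' F)) ∩ E := by
    intro x hx
    simp only [mem_sdiff, mem_inter_iff, mem_preimage, mem_union, hB] at hx ⊢
    tauto
  have h2 : (· + -z) ⁻¹' B ⊆ G \ ((· + -z) ⁻¹' G) := by
    intro x hx
    simp only [mem_sdiff, mem_inter_iff, mem_preimage, hB, hGdef, mem_iUnion,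
      neg_add_cancel_right] at hx ⊢
    refine ⟨⟨hx.2, 0, by simpa using hx.1.2⟩, fun h => h.1.2 hx.1.2⟩
  have h3 : G \ ((· + z) ⁻¹' G) ⊆ (F \ ((· + z) ⁻¹' F)) \ E := by
    intro x hx
    simp only [mem_sdiff, mem_inter_iff, mem_preimage, hGdef, mem_iUnion] at hx ⊢
    obtain ⟨⟨⟨hxF, hxE⟩, k, hk⟩, hx2⟩ := hx
    have hxz : x + z ∉ E := by
      intro h
      apply hxE
      have hk2 : (0 : ℝ) < k + 2 := by positivity
      -- The point `x` divides the segment from `x - (k + 1) z` to `x + z` with these weights.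
      have := hE hk h (a := 1 / (k + 2)) (b := (k + 1) / (k + 2)) (by positivity)
        (by positivity) (by field_simp; ring)
      convert this using 1
      ext i
      simp only [PiLp.add_apply, PiLp.smul_apply, PiLp.neg_apply, smul_eq_mul]
      field_simp
      ring
    refine ⟨⟨hxF, fun h => hx2 ⟨⟨h, hxz⟩, k + 1, ?_⟩⟩, hxE⟩
    convert hk using 1
    push_cast
    module
  calc volume ((F ∩ E) \ ((· + z) ⁻¹' (F ∩ E)))
      ≤ volume B + volume ((F \ ((· + z) ⁻¹' F)) ∩ E) :=
        (measure_mono h1).trans (measure_union_le _ _)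
    _ ≤ volume ((F \ ((· + z) ⁻¹' F)) \ E) + volume ((F \ ((· + z) ⁻¹' F)) ∩ E) := by
        refine add_le_add ?_ le_rfl
        rw [← measure_preimage_add_right volume (-z) B]
        refine (measure_mono h2).trans ?_
        rw [← measure_diff_translate_neg hGm hGfin]
        exact measure_mono h3
    _ = volume (F \ ((· + z) ⁻¹' F)) := by
        rw [add_comm, measure_inter_add_sdiff _ hEm]

/-- The frontier of a convex set is null. This allows a Borel set in place of `E`, which need not be
Borel. -/
theorem convex_interior_ae_eq {E : Set (Rn n)} (hE : Convex ℝ E) :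
    interior E =ᵐ[volume] E := by
  refine (interior_subset.eventuallyLE).antisymm ?_
  rw [ae_le_set]
  exact measure_mono_null (sdiff_subset_sdiff_left subset_closure) (hE.addHaar_frontier volume)

theorem perimeter_inter_convex_le {K : Rn n → ℝ≥0∞} (hK : Measurable K) {E F : Set (Rn n)}
    (hE : Convex ℝ E) (hF : NullMeasurableSet F volume) (hfin : volume F ≠ ∞) :
    perimeter K (F ∩ E) ≤ perimeter K F := by
  obtain ⟨F', -, hF'm, hF'⟩ := hF.exists_measurable_superset_ae_eq
  rw [perimeter_congr_ae K (hF'.symm.inter (convex_interior_ae_eq hE).symm),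
    perimeter_congr_ae K hF'.symm]
  rw [← measure_congr hF'] at hfin
  have hEm : MeasurableSet (interior E) := isOpen_interior.measurableSet
  rw [perimeter_eq_lintegral_translate hK hF'm,
    perimeter_eq_lintegral_translate hK (hF'm.inter hEm)]
  refine mul_le_mul_right (lintegral_mono fun z => mul_le_mul_left ?_ _) _
  rw [measure_symmDiff_translate hF'm hfin, measure_symmDiff_translate (hF'm.inter hEm)
    (measure_ne_top_of_subset inter_subset_left hfin)]
  gcongr 2 * ?_
  exact measure_inter_convex_diff_translate_le hE.interior hEm hF'm hfin z

/-! ### Coarea formula and lower semicontinuity. -/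

theorem ofReal_abs_sub_eq_lintegral_chi (u v : Rn n → ℝ) (x y : Rn n) :
    ENNReal.ofReal |u x - v y|
      = ∫⁻ t : ℝ, ENNReal.ofReal |chi {x | t < u x} x - chi {x | t < v x} y| := by
  classical
  simp_rw [ofReal_abs_chi_sub, mem_ofPred_eq]
  -- The levels `t` separating `u x` from `v y` fill a half-open interval of length `|u x - v y|`.
  -- Taking `v = u` serves the variation, taking `x = y` the fidelity term.
  have h : ∀ t : ℝ, (if (t < u x ↔ t < v y) then (0 : ℝ≥0∞) else 1)
      = (Ico (min (u x) (v y)) (max (u x) (v y))).indicator 1 t := by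
    intro t
    by_cases h1 : t < u x <;> by_cases h2 : t < v y <;> simp [indicator, h1, h2]
  simp_rw [h]
  rw [lintegral_indicator_one measurableSet_Ico, Real.volume_Ico, max_sub_min_eq_abs,
    abs_sub_comm]

theorem measurable_chi_superlevel {u : Rn n → ℝ} (hu : Measurable u) :
    Measurable fun p : ℝ × Rn n => chi {x | p.1 < u x} p.2 := by
  have : (fun p : ℝ × Rn n => chi {x | p.1 < u x} p.2)
      = {p : ℝ × Rn n | p.1 < u p.2}.indicator 1 := by
    ext p
    simp [chi, indicator]
  rw [this]
  exact measurable_one.indicator (measurableSet_lt measurable_fst (hu.comp measurable_snd))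

theorem measurable_variation_integrand_superlevel {K : Rn n → ℝ≥0∞} (hK : Measurable K)
    {u : Rn n → ℝ} (hu : Measurable u) :
    Measurable fun p : (Rn n × ℝ) × Rn n =>
      ENNReal.ofReal |chi {x | p.1.2 < u x} p.2 - chi {x | p.1.2 < u x} p.1.1|
        * K (p.2 - p.1.1) := by
  have h1 := (measurable_chi_superlevel hu).comp
    (g := fun p : ℝ × Rn n => chi {x | p.1 < u x} p.2)
    (f := fun p : (Rn n × ℝ) × Rn n => (p.1.2, p.2)) (by fun_prop)
  have h2 := (measurable_chi_superlevel hu).comp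
    (g := fun p : ℝ × Rn n => chi {x | p.1 < u x} p.2)
    (f := fun p : (Rn n × ℝ) × Rn n => (p.1.2, p.1.1)) (by fun_prop)
  simp only [Function.comp_def] at h1 h2
  exact (h1.sub h2).abs.ennreal_ofReal.mul (by fun_prop)

/-- Coarea formula for the `K`-variation. -/
theorem variation_eq_lintegral_perimeter {K : Rn n → ℝ≥0∞} (hK : Measurable K)
    {u : Rn n → ℝ} (hu : Measurable u) :
    variation K u = ∫⁻ t : ℝ, perimeter K {x | t < u x} := by
  have hm := measurable_variation_integrand_superlevel hK hu
  have h1 : ∀ y, ∫⁻ x, ENNReal.ofReal |u x - u y| * K (x - y)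
      = ∫⁻ t : ℝ, ∫⁻ x, ENNReal.ofReal |chi {x | t < u x} x - chi {x | t < u x} y|
        * K (x - y) := by
    intro y
    rw [lintegral_lintegral_swap]
    · refine lintegral_congr fun x => ?_
      rw [ofReal_abs_sub_eq_lintegral_chi, lintegral_mul_const]
      have h1 := (measurable_chi_superlevel hu).comp (f := fun t : ℝ => (t, x)) (by fun_prop)
      have h2 := (measurable_chi_superlevel hu).comp (f := fun t : ℝ => (t, y)) (by fun_prop)
      exact (h1.sub h2).abs.ennreal_ofReal
    · exact (hm.comp (f := fun p : ℝ × Rn n => ((y, p.1), p.2)) (by fun_prop)).aemeasurable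
  unfold perimeter variation
  simp_rw [h1]
  rw [lintegral_const_mul, lintegral_lintegral_swap]
  · exact hm.lintegral_prod_right'.aemeasurable
  · exact (hm.lintegral_prod_right'.comp measurable_swap).lintegral_prod_right'

theorem lintegral_abs_sub_eq_lintegral_chi {ν : Measure (Rn n)} [SFinite ν]
    {u v : Rn n → ℝ} (hu : Measurable u) (hv : Measurable v) :
    ∫⁻ x, ENNReal.ofReal |u x - v x| ∂ν
      = ∫⁻ t : ℝ, ∫⁻ x, ENNReal.ofReal |chi {x | t < u x} x - chi {x | t < v x} x| ∂ν := by
  rw [lintegral_lintegral_swap]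
  · exact lintegral_congr fun x => ofReal_abs_sub_eq_lintegral_chi u v x x
  · exact ((measurable_chi_superlevel hu).sub
      (measurable_chi_superlevel hv)).abs.ennreal_ofReal.aemeasurable

/-- Lower semicontinuity of the `K`-perimeter. -/
theorem perimeter_le_of_forall_le {K : Rn n → ℝ≥0∞} (hK : Measurable K)
    {U : ℕ → Set (Rn n)} (hU : ∀ k, MeasurableSet (U k)) {V : Set (Rn n)}
    (hV : ∀ x, ∀ᶠ k in Filter.atTop, (x ∈ U k ↔ x ∈ V)) {a : ℝ≥0∞}
    (ha : ∀ k, perimeter K (U k) ≤ a) : perimeter K V ≤ a := by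
  have hm : ∀ k, Measurable fun p : Rn n × Rn n =>
      ENNReal.ofReal |chi (U k) p.2 - chi (U k) p.1| * K (p.2 - p.1) := by
    intro k
    have := measurable_chi (hU k)
    fun_prop
  have hle : ∀ W : Set (Rn n), perimeter K W ≤ a ↔
      ∫⁻ y, ∫⁻ x, ENNReal.ofReal |chi W x - chi W y| * K (x - y) ≤ 2 * a := by
    intro W
    unfold perimeter variation
    rw [ENNReal.inv_mul_le_iff (by simp) (by simp)]
  rw [hle]
  simp_rw [hle] at ha
  have hlim : ∀ x y, ENNReal.ofReal |chi V x - chi V y| * K (x - y)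
      = Filter.liminf (fun k => ENNReal.ofReal |chi (U k) x - chi (U k) y| * K (x - y))
        Filter.atTop := by
    intro x y
    -- The integrand is eventually constant in `k` at each pair of points, so Fatou's lemma applies
    -- twice.
    refine (Filter.Tendsto.liminf_eq (tendsto_const_nhds.congr' ?_)).symm
    filter_upwards [hV x, hV y] with k hx hy
    classical
    simp [ofReal_abs_chi_sub, hx, hy]
  calc ∫⁻ y, ∫⁻ x, ENNReal.ofReal |chi V x - chi V y| * K (x - y)
      ≤ ∫⁻ y, Filter.liminf (fun k => ∫⁻ x, ENNReal.ofReal |chi (U k) x - chi (U k) y|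
          * K (x - y)) Filter.atTop := by
        refine lintegral_mono fun y => ?_
        simp_rw [hlim]
        exact lintegral_liminf_le fun k =>
          (hm k).comp (f := fun x : Rn n => (y, x)) (by fun_prop)
    _ ≤ Filter.liminf (fun k => ∫⁻ y, ∫⁻ x, ENNReal.ofReal |chi (U k) x - chi (U k) y|
          * K (x - y)) Filter.atTop :=
        lintegral_liminf_le fun k => (hm k).lintegral_prod_right'
    _ ≤ 2 * a := Filter.liminf_le_of_frequently_le' (Filter.Frequently.of_forall ha)

/-! ### Perimeter of balls, positivity of the kernel, perimeter bounds from below. -/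

theorem measure_ball_diff_translate_le [NeZero n] (x₀ : Rn n) {r : ℝ} (hr : 0 < r) (z : Rn n) :
    volume (Metric.ball x₀ r \ ((· + z) ⁻¹' Metric.ball x₀ r))
      ≤ volume (Metric.ball x₀ r) * ENNReal.ofReal (n / r * ‖z‖) := by
  rcases lt_or_ge r ‖z‖ with hz | hz
  · refine (measure_mono sdiff_subset).trans (le_mul_of_one_le_right' ?_)
    rw [ENNReal.one_le_ofReal]
    have : (1 : ℝ) ≤ n := by exact_mod_cast NeZero.one_le
    calc (1 : ℝ) ≤ n := this
      _ = n / r * r := by field_simp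
      _ ≤ n / r * ‖z‖ := by gcongr
  · have hsub : Metric.ball x₀ (r - ‖z‖) ⊆ (· + z) ⁻¹' Metric.ball x₀ r := by
      intro x hx
      simp only [mem_preimage, Metric.mem_ball, dist_eq_norm] at hx ⊢
      calc ‖x + z - x₀‖ = ‖(x - x₀) + z‖ := by congr 1; abel
        _ ≤ ‖x - x₀‖ + ‖z‖ := norm_add_le _ _
        _ < r := by linarith
    refine (measure_mono (sdiff_subset_sdiff_right hsub)).trans ?_
    rw [measure_sdiff (Metric.ball_subset_ball (by linarith [norm_nonneg z]))
      Metric.isOpen_ball.measurableSet.nullMeasurableSet measure_ball_lt_top.ne,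
      Measure.addHaar_ball _ _ hr.le, Measure.addHaar_ball _ _ (sub_nonneg.2 hz),
      finrank_euclideanSpace_fin, mul_right_comm, ← ENNReal.sub_mul
        (fun _ _ => measure_ball_lt_top.ne), ← ENNReal.ofReal_sub _ (by
        have := sub_nonneg.2 hz; positivity), ← ENNReal.ofReal_mul (by positivity)]
    gcongr
    -- Bernoulli: `(r - ‖z‖)^n ≥ r^n (1 - n ‖z‖ / r)`, applied to the concentric ball that stays
    -- inside after translation.
    have hb := one_add_mul_le_pow (a := -(‖z‖ / r)) (by
      have : ‖z‖ / r ≤ 1 := by rw [div_le_one hr]; exact hz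
      linarith) n
    have he : (r - ‖z‖) ^ n = r ^ n * (1 + -(‖z‖ / r)) ^ n := by
      rw [← mul_pow]
      congr 1
      field_simp
      ring
    rw [he]
    have := mul_le_mul_of_nonneg_left hb (by positivity : 0 ≤ r ^ n)
    calc r ^ n - r ^ n * (1 + -(‖z‖ / r)) ^ n
        ≤ r ^ n - r ^ n * (1 + n * -(‖z‖ / r)) := by linarith
      _ = r ^ n * (n / r * ‖z‖) := by field_simp; ring

theorem perimeter_ball_lt_top [NeZero n] {K : Rn n → ℝ≥0∞} (hK : Measurable K)
    (hNts : NotTooSingular K) (x₀ : Rn n) {r : ℝ} (hr : 0 < r) :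
    perimeter K (Metric.ball x₀ r) < ∞ := by
  rw [perimeter_eq_lintegral_translate hK Metric.isOpen_ball.measurableSet]
  refine ENNReal.mul_lt_top (by simp) ?_
  set L : ℝ := 1 + n / r with hL
  have hn : 0 ≤ n / r := by positivity
  -- The constant `L = 1 + n / r` covers both the trivial bound for `‖z‖ ≥ 1` and the linear one for
  -- `‖z‖ ≤ 1`.
  have hbound : ∀ z : Rn n,
      volume (Metric.ball x₀ r ∆ ((· + z) ⁻¹' Metric.ball x₀ r)) * K z
        ≤ 2 * volume (Metric.ball x₀ r) * ENNReal.ofReal L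
          * (ENNReal.ofReal (min 1 ‖z‖) * K z) := by
    intro z
    rw [measure_symmDiff_translate Metric.isOpen_ball.measurableSet measure_ball_lt_top.ne]
    have key : volume (Metric.ball x₀ r \ ((· + z) ⁻¹' Metric.ball x₀ r))
        ≤ volume (Metric.ball x₀ r) * ENNReal.ofReal (L * min 1 ‖z‖) := by
      rcases le_total 1 ‖z‖ with h | h
      · rw [min_eq_left h]
        refine (measure_mono sdiff_subset).trans (le_mul_of_one_le_right' ?_)
        rw [ENNReal.one_le_ofReal]
        linarith
      · rw [min_eq_right h]
        refine (measure_ball_diff_translate_le x₀ hr z).trans ?_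
        gcongr
        linarith
    calc _ ≤ 2 * (volume (Metric.ball x₀ r) * ENNReal.ofReal (L * min 1 ‖z‖)) * K z := by
          exact mul_le_mul_left (mul_le_mul_right key _) _
      _ = _ := by
          rw [ENNReal.ofReal_mul (by positivity)]
          ring
  refine (lintegral_mono hbound).trans_lt ?_
  rw [lintegral_const_mul _ (by fun_prop)]
  exact ENNReal.mul_lt_top (ENNReal.mul_lt_top (ENNReal.mul_lt_top (by simp)
    measure_ball_lt_top) (by simp)) hNts

/-- A zero at `x` propagates by doubling to every `x / 2^k`, and from there by (Dec) to all points
of larger norm. So `K` would vanish off the origin, hence a.e. -/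
theorem kernel_ne_zero [NeZero n] {K : Rn n → ℝ≥0∞} {q : ℝ} (hK : IsKernel K)
    (hDec : DecreasingExp q K) (hDou : Doubling ∞ K) {x : Rn n} (hx : x ≠ 0) : K x ≠ 0 := by
  intro h0
  obtain ⟨C, -, hC⟩ := hDou
  have hk : ∀ k : ℕ, K ((1 / 2 : ℝ) ^ k • x) = 0 := by
    intro k
    induction k with
    | zero => simpa using h0
    | succ k ih =>
      have := hC ((1 / 2 : ℝ) ^ (k + 1) • x) ((1 / 2 : ℝ) ^ k • x)
        (by simp only [norm_smul, norm_pow, pow_succ]; norm_num; ring) (by simp)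
      rwa [ih, mul_zero, nonpos_iff_eq_zero] at this
  have hy : ∀ y : Rn n, y ≠ 0 → K y = 0 := by
    intro y hy
    have hxp : 0 < ‖x‖ := norm_pos_iff.2 hx
    have hyp : 0 < ‖y‖ := norm_pos_iff.2 hy
    obtain ⟨k, hk'⟩ := exists_pow_lt_of_lt_one (div_pos hyp hxp) (by norm_num : (1 / 2 : ℝ) < 1)
    have hnorm : ‖(1 / 2 : ℝ) ^ k • x‖ = (1 / 2 : ℝ) ^ k * ‖x‖ := by
      rw [norm_smul, norm_pow]; norm_num
    have := hDec ((1 / 2 : ℝ) ^ k • x) y (by rw [hnorm]; positivity)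
      (by rw [hnorm]; exact ((lt_div_iff₀ hxp).1 hk').le)
    rw [hk k, zero_mul, nonpos_iff_eq_zero, mul_eq_zero] at this
    refine this.resolve_right ?_
    simpa using Real.rpow_pos_of_pos hyp q
  refine hK.2 ?_
  have : ∀ᵐ y : Rn n, y ≠ 0 := by simp [ae_iff]
  filter_upwards [this] with y hy'
  exact hy y hy'

theorem setLIntegral_kernel_pos [NeZero n] {K : Rn n → ℝ≥0∞} (hK : Measurable K)
    (hpos : ∀ x, x ≠ 0 → K x ≠ 0) {R : ℝ} (hR : 0 ≤ R) :
    0 < ∫⁻ z in {z : Rn n | R < ‖z‖}, K z := by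
  have ho : IsOpen {z : Rn n | R < ‖z‖} := isOpen_lt continuous_const continuous_norm
  rw [setLIntegral_pos_iff hK]
  obtain ⟨x, hx⟩ := NormedSpace.exists_lt_norm ℝ (Rn n) R
  have hsub : {z : Rn n | R < ‖z‖} ⊆ Function.support K ∩ {z : Rn n | R < ‖z‖} := by
    intro z hz
    refine ⟨hpos z ?_, hz⟩
    rintro rfl
    simp at hz
    linarith
  exact (ho.measure_pos volume ⟨x, hx⟩).trans_le (measure_mono hsub)

/-- A translation by `z` with `‖z‖ > 2R` moves `F` off itself, so the symmetric difference has
measure `2|F|`, which absorbs the factor `1/2`. -/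
theorem mul_measure_le_perimeter {K : Rn n → ℝ≥0∞} (hK : Measurable K) {F : Set (Rn n)}
    (hF : NullMeasurableSet F volume) {R : ℝ} (hFR : F ⊆ Metric.ball 0 R) :
    (∫⁻ z in {z : Rn n | 2 * R < ‖z‖}, K z) * volume F ≤ perimeter K F := by
  obtain ⟨F', hF's, hF'm, hF'⟩ := hF.exists_measurable_subset_ae_eq
  rw [perimeter_congr_ae K hF'.symm, ← measure_congr hF']
  have hfin : volume F' ≠ ∞ :=
    measure_ne_top_of_subset (hF's.trans hFR) measure_ball_lt_top.ne
  have hR : MeasurableSet {z : Rn n | 2 * R < ‖z‖} :=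
    measurableSet_lt measurable_const measurable_norm
  rw [perimeter_eq_lintegral_translate hK hF'm, mul_comm, ← ENNReal.mul_le_iff_le_inv
    (by simp) (by simp), ← lintegral_const_mul _ hK, ← lintegral_const_mul' _ _ (by simp)]
  refine (setLIntegral_mono' hR fun z hz => ?_).trans (setLIntegral_le_lintegral _ _)
  have hd : F' \ ((· + z) ⁻¹' F') = F' := by
    rw [sdiff_eq_left, Set.disjoint_left]
    intro x hx hxz
    have h1 := hFR (hF's hx)
    have h2 := hFR (hF's hxz)
    simp only [mem_ball_zero_iff, mem_ofPred_eq] at h1 h2 hz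
    have : ‖z‖ ≤ ‖x + z‖ + ‖x‖ := by
      simpa using norm_sub_le (x + z) x
    linarith
  rw [measure_symmDiff_translate hF'm hfin, hd, ← mul_assoc]

/-! ### Comparison of `ν` with Lebesgue measure. -/

theorem AdmissibleWeight.exists_bounds {ν : Measure (Rn n)} (hν : AdmissibleWeight ν) :
    ∃ c M : ℝ≥0, 0 < c ∧ 0 < M ∧ c • volume ≤ ν ∧ ν ≤ M • volume := by
  obtain ⟨w, hw, hM, hc, rfl⟩ := hν
  obtain ⟨c, hc0, hc⟩ := ENNReal.lt_iff_exists_nnreal_btwn.1 hc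
  obtain ⟨M, hM0, -⟩ := ENNReal.lt_iff_exists_nnreal_btwn.1 hM
  have h : ∀ a : ℝ≥0, a • (volume : Measure (Rn n)) = volume.withDensity fun _ => (a : ℝ≥0∞) :=
    fun a => (withDensity_const _).symm
  refine ⟨c, M, by exact_mod_cast hc0, ?_, ?_, ?_⟩
  · exact_mod_cast (zero_le (a := essSup w volume)).trans_lt hM0
  · rw [h]
    refine withDensity_mono ?_
    filter_upwards [ae_essInf_le (f := w) (μ := volume)] with x hx
    exact hc.le.trans hx
  · rw [h]
    refine withDensity_mono ?_
    filter_upwards [ENNReal.ae_le_essSup w] with x hx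
    exact hx.trans hM0.le

section Weight

variable {ν : Measure (Rn n)}

theorem AdmissibleWeight.sfinite (hν : AdmissibleWeight ν) : SFinite ν := by
  obtain ⟨w, -, -, -, rfl⟩ := hν
  infer_instance

theorem AdmissibleWeight.absolutelyContinuous (hν : AdmissibleWeight ν) : ν ≪ volume := by
  obtain ⟨w, -, -, -, rfl⟩ := hν
  exact withDensity_absolutelyContinuous _ _

theorem AdmissibleWeight.measure_eq_zero_iff (hν : AdmissibleWeight ν) {U : Set (Rn n)} :
    ν U = 0 ↔ volume U = 0 := by
  refine ⟨fun h => ?_, fun h => hν.absolutelyContinuous h⟩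
  obtain ⟨c, M, hc, -, hcν, -⟩ := hν.exists_bounds
  have := hcν U
  rw [h, nonpos_iff_eq_zero, Measure.smul_apply, smul_eq_zero] at this
  exact this.resolve_left hc.ne'

theorem AdmissibleWeight.measure_lt_top_iff (hν : AdmissibleWeight ν) {U : Set (Rn n)} :
    ν U < ∞ ↔ volume U < ∞ := by
  obtain ⟨c, M, hc, -, hcν, hMν⟩ := hν.exists_bounds
  constructor
  · intro h
    have := (hcν U).trans_lt h
    rw [Measure.smul_apply, ENNReal.smul_def, smul_eq_mul] at this
    exact ENNReal.lt_top_of_mul_ne_top_right this.ne (by exact_mod_cast hc.ne')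
  · intro h
    refine (hMν U).trans_lt ?_
    rw [Measure.smul_apply, ENNReal.smul_def, smul_eq_mul]
    exact ENNReal.mul_lt_top (by simp) h

end Weight

/-! ### The geometric problem and the Cheeger constant. -/

section Energy

variable {K : Rn n → ℝ≥0∞} {ν : Measure (Rn n)} {E U V : Set (Rn n)} {Λ : ℝ≥0}

theorem geometricEnergy_congr_ae (hν : AdmissibleWeight ν) (h : U =ᵐ[volume] V) :
    geometricEnergy K ν E Λ U = geometricEnergy K ν E Λ V := by
  unfold geometricEnergy
  rw [perimeter_congr_ae K h, measure_congr ((ae_eq_refl E).symmDiff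
    (hν.absolutelyContinuous.ae_eq h))]

theorem geometricEnergy_eq (hν : AdmissibleWeight ν) (hE : NullMeasurableSet E volume)
    (hU : NullMeasurableSet U volume) :
    geometricEnergy K ν E Λ U = perimeter K U + Λ * ν (E \ U) + Λ * ν (U \ E) := by
  unfold geometricEnergy
  rw [measure_symmDiff_eq (hE.mono_ac hν.absolutelyContinuous)
    (hU.mono_ac hν.absolutelyContinuous), mul_add, add_assoc]

@[simp]
theorem perimeter_empty (K : Rn n → ℝ≥0∞) : perimeter K ∅ = 0 := by
  simp [perimeter, variation, chi]

theorem geometricEnergy_empty : geometricEnergy K ν E Λ ∅ = Λ * ν E := by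
  simp [geometricEnergy, symmDiff_of_ge (empty_subset E)]

theorem perimeter_inter_add_le_geometricEnergy (hK : Measurable K) (hν : AdmissibleWeight ν)
    (hE : Convex ℝ E) (hEfin : volume E < ∞) (hU : NullMeasurableSet U volume) (hΛ : 0 < Λ) :
    perimeter K (U ∩ E) + Λ * ν (E \ U) + Λ * ν (U \ E) ≤ geometricEnergy K ν E Λ U := by
  rw [geometricEnergy_eq hν (hE.nullMeasurableSet volume) hU]
  by_cases hfin : volume U = ∞
  -- The cutting inequality needs finite measure; otherwise the fidelity term alone is infinite.
  · have : ν (U \ E) = ∞ := by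
      by_contra h
      have h1 := hν.measure_lt_top_iff.1 (lt_top_iff_ne_top.2 h)
      have h2 := measure_mono (μ := volume) (subset_sdiff_union U E)
      rw [hfin] at h2
      exact (h2.trans (measure_union_le _ _)).not_gt (ENNReal.add_lt_top.2 ⟨h1, hEfin⟩)
    rw [this, ENNReal.mul_top (by exact_mod_cast hΛ.ne')]
    simp
  · gcongr
    exact perimeter_inter_convex_le hK hE hU hfin

theorem cheegerConst_mul_le (hν : AdmissibleWeight ν) (hEfin : volume E < ∞)
    (hU : NullMeasurableSet U volume) (hUE : U ⊆ E) :
    cheegerConst K ν E * ν U ≤ perimeter K U := by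
  rcases eq_or_ne (volume U) 0 with h | h
  · simp [hν.measure_eq_zero_iff.2 h]
  · have h1 : volume U < ∞ := (measure_mono hUE).trans_lt hEfin
    exact ENNReal.mul_le_of_le_div (sInf_le ⟨U, ⟨hU, hUE, pos_iff_ne_zero.2 h, h1⟩, rfl⟩)

theorem AdmissibleWeight.measure_inter_add_sdiff (hν : AdmissibleWeight ν)
    (hU : NullMeasurableSet U volume) : ν (U ∩ E) + ν (E \ U) = ν E := by
  rw [inter_comm, measure_inter_add_sdiff₀ _ (hU.mono_ac hν.absolutelyContinuous)]

theorem mul_measure_le_geometricEnergy (hK : Measurable K) (hν : AdmissibleWeight ν)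
    (hE : Convex ℝ E) (hEfin : volume E < ∞) (hΛ : 0 < Λ) (hΛh : Λ ≤ cheegerConst K ν E)
    (hU : NullMeasurableSet U volume) :
    Λ * ν E ≤ geometricEnergy K ν E Λ U := by
  refine le_trans ?_ (perimeter_inter_add_le_geometricEnergy hK hν hE hEfin hU hΛ)
  rw [← hν.measure_inter_add_sdiff (E := E) hU, mul_add]
  refine le_trans (add_le_add ?_ le_rfl) le_self_add
  exact (mul_le_mul_left hΛh _).trans (cheegerConst_mul_le hν hEfin
    (hU.inter (hE.nullMeasurableSet volume)) inter_subset_right)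

theorem mem_geometricSol_iff_energy_le (hK : Measurable K) (hν : AdmissibleWeight ν)
    (hE : Convex ℝ E) (hEfin : volume E < ∞) (hΛ : 0 < Λ) (hΛh : Λ ≤ cheegerConst K ν E) :
    U ∈ geometricSol K ν E Λ ↔
      NullMeasurableSet U volume ∧ geometricEnergy K ν E Λ U ≤ Λ * ν E := by
  constructor
  · rintro ⟨h1, -, h2⟩
    exact ⟨h1, geometricEnergy_empty (K := K) (ν := ν) (E := E) (Λ := Λ) ▸
      h2 ∅ nullMeasurableSet_empty⟩
  · rintro ⟨h1, h2⟩
    exact ⟨h1, h2.trans_lt (ENNReal.mul_lt_top (by simp) (hν.measure_lt_top_iff.2 hEfin)),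
      fun V hV => h2.trans (mul_measure_le_geometricEnergy hK hν hE hEfin hΛ hΛh hV)⟩

/-- The equality case of the lower bound, in the form shared by `Λ < h` and `Λ = h`. -/
theorem mem_geometricSol_iff (hK : Measurable K) (hν : AdmissibleWeight ν)
    (hE : Convex ℝ E) (hEfin : volume E < ∞) (hΛ : 0 < Λ) (hΛh : Λ ≤ cheegerConst K ν E) :
    U ∈ geometricSol K ν E Λ ↔
      ∃ V : Set (Rn n), U =ᵐ[volume] V ∧ NullMeasurableSet V volume ∧ V ⊆ E ∧
        perimeter K V ≤ Λ * ν V := by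
  have hEm : NullMeasurableSet E volume := hE.nullMeasurableSet volume
  rw [mem_geometricSol_iff_energy_le hK hν hE hEfin hΛ hΛh]
  have hνE : ν E < ∞ := hν.measure_lt_top_iff.2 hEfin
  constructor
  · rintro ⟨h1, h2⟩
    have h3 := (perimeter_inter_add_le_geometricEnergy hK hν hE hEfin h1 hΛ).trans h2
    have hm := h1.inter hEm
    rw [← hν.measure_inter_add_sdiff (E := E) h1, mul_add, add_right_comm] at h3
    have hfin : ∀ {W}, W ⊆ E → Λ * ν W ≠ ∞ := fun {W} hW =>
      (ENNReal.mul_lt_top (by simp) ((measure_mono hW).trans_lt hνE)).ne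
    have h4 := ENNReal.le_of_add_le_add_right (hfin sdiff_subset) h3
    refine ⟨U ∩ E, ?_, hm, inter_subset_right, le_self_add.trans h4⟩
    -- `P_K(U ∩ E)` is at least `Λ ν(U ∩ E)`, so no room is left for `ν(U \ E)`.
    have h5 : Λ * ν (U ∩ E) + Λ * ν (U \ E) ≤ Λ * ν (U ∩ E) + 0 := by
      rw [add_zero]
      refine le_trans (add_le_add ?_ le_rfl) h4
      exact (mul_le_mul_left hΛh _).trans (cheegerConst_mul_le hν hEfin hm inter_subset_right)
    have h6 := ENNReal.le_of_add_le_add_left (hfin inter_subset_right) h5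
    rw [nonpos_iff_eq_zero, mul_eq_zero, hν.measure_eq_zero_iff, ← ae_le_set] at h6
    have h7 : U ≤ᵐ[volume] E := h6.resolve_left (by exact_mod_cast hΛ.ne')
    refine Filter.EventuallyLE.antisymm ?_ inter_subset_left.eventuallyLE
    simpa using (Filter.EventuallyLE.refl _ U).inter h7
  · rintro ⟨V, hUV, hV, hVE, hP⟩
    refine ⟨hV.congr hUV.symm, ?_⟩
    rw [geometricEnergy_congr_ae hν hUV, geometricEnergy_eq hν hEm hV,
      sdiff_eq_empty.2 hVE, measure_empty, mul_zero, add_zero]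
    calc perimeter K V + Λ * ν (E \ V) ≤ Λ * ν V + Λ * ν (E \ V) := by gcongr
      _ = Λ * ν E := by
        rw [← mul_add, ← hν.measure_inter_add_sdiff (E := E) hV,
          inter_eq_left.2 hVE]

theorem empty_mem_geometricSol (hK : Measurable K) (hν : AdmissibleWeight ν)
    (hE : Convex ℝ E) (hEfin : volume E < ∞) (hΛ : 0 < Λ) (hΛh : Λ ≤ cheegerConst K ν E) :
    ∅ ∈ geometricSol K ν E Λ :=
  (mem_geometricSol_iff_energy_le hK hν hE hEfin hΛ hΛh).2
    ⟨nullMeasurableSet_empty, geometricEnergy_empty.le⟩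

theorem le_cheegerConst_of_empty_mem_geometricSol (hν : AdmissibleWeight ν)
    (hEfin : volume E < ∞) (h : ∅ ∈ geometricSol K ν E Λ) : Λ ≤ cheegerConst K ν E := by
  refine le_sInf ?_
  rintro _ ⟨F, ⟨hF, hFE, hF0, hFfin⟩, rfl⟩
  have hνF : ν F < ∞ := hν.measure_lt_top_iff.2 hFfin
  have h1 := h.2.2 F hF
  rw [geometricEnergy_empty, ← hν.measure_inter_add_sdiff (E := E) hF,
    geometricEnergy, inter_eq_left.2 hFE, symmDiff_of_ge hFE, mul_add] at h1
  have h2 : Λ * ν (E \ F) ≠ ∞ := (ENNReal.mul_lt_top (by simp)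
    (hν.measure_lt_top_iff.2 ((measure_mono sdiff_subset).trans_lt hEfin))).ne
  rw [ENNReal.le_div_iff_mul_le (Or.inl (by rw [Ne, hν.measure_eq_zero_iff]; exact hF0.ne'))
    (Or.inl hνF.ne)]
  exact ENNReal.le_of_add_le_add_right h2 h1

theorem geometricSol_of_lt_cheegerConst (hK : Measurable K) (hν : AdmissibleWeight ν)
    (hE : Convex ℝ E) (hEfin : volume E < ∞) (hΛ : 0 < Λ) (hΛh : Λ < cheegerConst K ν E) :
    geometricSol K ν E Λ = upToNull {∅} := by
  ext U
  rw [mem_geometricSol_iff hK hν hE hEfin hΛ hΛh.le]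
  constructor
  · rintro ⟨V, hUV, hV, hVE, hP⟩
    refine ⟨∅, rfl, hUV.trans ?_⟩
    rw [ae_eq_empty, ← hν.measure_eq_zero_iff]
    by_contra h0
    refine ((cheegerConst_mul_le hν hEfin hV hVE).trans hP).not_gt ?_
    exact ENNReal.mul_lt_mul_left h0
      (hν.measure_lt_top_iff.2 ((measure_mono hVE).trans_lt hEfin)).ne hΛh
  · rintro ⟨_, rfl, hU⟩
    exact ⟨∅, hU, nullMeasurableSet_empty, empty_subset _, by simp⟩

theorem geometricSol_of_eq_cheegerConst (hK : Measurable K) (hν : AdmissibleWeight ν)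
    (hE : Convex ℝ E) (hEfin : volume E < ∞) (hΛ : 0 < Λ) (hΛh : Λ = cheegerConst K ν E) :
    geometricSol K ν E Λ = upToNull (cheegerSets K ν E ∪ {∅}) := by
  ext U
  rw [mem_geometricSol_iff hK hν hE hEfin hΛ hΛh.le]
  constructor
  · rintro ⟨V, hUV, hV, hVE, hP⟩
    rcases eq_or_ne (volume V) 0 with h0 | h0
    · exact ⟨∅, Or.inr rfl, hUV.trans (ae_eq_empty.2 h0)⟩
    · have hVfin := (measure_mono hVE).trans_lt hEfin
      refine ⟨V, Or.inl ⟨⟨hV, hVE, pos_iff_ne_zero.2 h0, hVfin⟩, le_antisymm ?_ ?_⟩, hUV⟩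
      · rw [← hΛh]
        exact ENNReal.div_le_of_le_mul hP
      · exact sInf_le ⟨V, ⟨hV, hVE, pos_iff_ne_zero.2 h0, hVfin⟩, rfl⟩
  · rintro ⟨V, ⟨⟨hV, hVE, hV0, hVfin⟩, hP⟩ | rfl, hU⟩
    · refine ⟨V, hU, hV, hVE, ?_⟩
      rw [hΛh, ← hP, ENNReal.div_mul_cancel (by rw [Ne, hν.measure_eq_zero_iff]; exact hV0.ne')
        (hν.measure_lt_top_iff.2 hVfin).ne]
    · exact ⟨∅, hU, nullMeasurableSet_empty, empty_subset _, by simp⟩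

theorem geometricSol_of_cheegerConst_lt (hK : Measurable K) (hν : AdmissibleWeight ν)
    (hE : Convex ℝ E) (hEfin : volume E < ∞) (hΛh : cheegerConst K ν E < Λ)
    (hcal : Calibrable K ν E) :
    geometricSol K ν E Λ = upToNull {E} := by
  have hΛ : 0 < Λ := by exact_mod_cast (zero_le (a := cheegerConst K ν E)).trans_lt hΛh
  have hEm : NullMeasurableSet E volume := hE.nullMeasurableSet volume
  have hνE : ν E < ∞ := hν.measure_lt_top_iff.2 hEfin
  have hh : cheegerConst K ν E ≠ ∞ := hΛh.ne_top
  have hEE : geometricEnergy K ν E Λ E = cheegerConst K ν E * ν E := by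
    obtain ⟨-, ⟨-, -, hE0, -⟩, hP⟩ := hcal
    rw [← hP, ENNReal.div_mul_cancel (by rw [Ne, hν.measure_eq_zero_iff]; exact hE0.ne') hνE.ne]
    simp [geometricEnergy]
  have hlow : ∀ V, NullMeasurableSet V volume →
      cheegerConst K ν E * ν (V ∩ E) + Λ * ν (E \ V) + Λ * ν (V \ E)
        ≤ geometricEnergy K ν E Λ V := by
    intro V hV
    refine le_trans ?_ (perimeter_inter_add_le_geometricEnergy hK hν hE hEfin hV hΛ)
    gcongr
    exact cheegerConst_mul_le hν hEfin (hV.inter hEm) inter_subset_right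
  ext U
  constructor
  · rintro ⟨hU, -, hmin⟩
    refine ⟨E, rfl, ?_⟩
    have h1 := (hlow U hU).trans ((hmin E hEm).trans_eq hEE)
    have hfin : ν (E \ U) ≠ ∞ := ((measure_mono sdiff_subset).trans_lt hνE).ne
    rw [← hν.measure_inter_add_sdiff (E := E) hU, mul_add, add_assoc] at h1
    have h2 := ENNReal.le_of_add_le_add_left (ENNReal.mul_lt_top hh.lt_top
      ((measure_mono inter_subset_right).trans_lt hνE)).ne h1
    have h3 : ν (E \ U) = 0 := by
      by_contra h0
      exact (le_self_add.trans h2).not_gt (ENNReal.mul_lt_mul_left h0 hfin hΛh)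
    rw [h3, mul_zero, mul_zero, zero_add, nonpos_iff_eq_zero, mul_eq_zero] at h2
    have h4 := h2.resolve_left (by exact_mod_cast hΛ.ne')
    rw [hν.measure_eq_zero_iff, ← ae_le_set] at h3 h4
    exact h4.antisymm h3
  · rintro ⟨_, rfl, hU⟩
    refine ⟨hEm.congr hU.symm, ?_, ?_⟩
    · rw [geometricEnergy_congr_ae hν hU, hEE]
      exact ENNReal.mul_lt_top hh.lt_top hνE
    · intro V hV
      rw [geometricEnergy_congr_ae hν hU, hEE]
      refine le_trans ?_ (hlow V hV)
      rw [← hν.measure_inter_add_sdiff (E := _) hV, mul_add]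
      exact (add_le_add le_rfl (mul_le_mul_left hΛh.le _)).trans le_self_add

theorem cheegerConst_pos [NeZero n] (hK : Measurable K) (hpos : ∀ x, x ≠ 0 → K x ≠ 0)
    (hν : AdmissibleWeight ν) (hE : Bornology.IsBounded E) : 0 < cheegerConst K ν E := by
  obtain ⟨R, hR, hER⟩ := hE.subset_ball_lt 0 0
  obtain ⟨c, M, hc, hM, hcν, hMν⟩ := hν.exists_bounds
  set κ := ∫⁻ z in {z : Rn n | 2 * R < ‖z‖}, K z with hκ
  have hκ0 : 0 < κ := setLIntegral_kernel_pos hK hpos (by positivity)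
  refine lt_of_lt_of_le (ENNReal.div_pos hκ0.ne' (ENNReal.coe_ne_top (r := M))) (le_sInf ?_)
  rintro _ ⟨F, ⟨hF, hFE, hF0, hFfin⟩, rfl⟩
  rw [ENNReal.le_div_iff_mul_le (Or.inl (by rw [Ne, hν.measure_eq_zero_iff]; exact hF0.ne'))
    (Or.inl (hν.measure_lt_top_iff.2 hFfin).ne)]
  have h1 : ν F ≤ M * volume F := hMν F
  calc κ / M * ν F ≤ κ / M * (M * volume F) := by gcongr
    _ = κ * volume F := by
      rw [← mul_assoc, ENNReal.div_mul_cancel (by exact_mod_cast hM.ne') (by simp)]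
    _ ≤ perimeter K F := mul_measure_le_perimeter hK hF (hFE.trans hER)

theorem cheegerConst_lt_top [NeZero n] (hK : Measurable K) (hNts : NotTooSingular K)
    (hν : AdmissibleWeight ν) (hE : (interior E).Nonempty) : cheegerConst K ν E < ∞ := by
  obtain ⟨x, hx⟩ := hE
  obtain ⟨r, hr, hxr⟩ := Metric.isOpen_iff.1 isOpen_interior x hx
  have h0 : 0 < volume (Metric.ball x r) := Metric.measure_ball_pos _ _ hr
  have hB : Metric.ball x r ∈ cheegerCompetitors E :=
    ⟨Metric.isOpen_ball.measurableSet.nullMeasurableSet, hxr.trans interior_subset, h0,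
      measure_ball_lt_top⟩
  refine (sInf_le (mem_image_of_mem _ hB)).trans_lt ?_
  refine ENNReal.div_lt_top (perimeter_ball_lt_top hK hNts x hr).ne ?_
  rw [Ne, hν.measure_eq_zero_iff]
  exact h0.ne'

end Energy

/-! ### The functional problem, level by level. -/

section Relaxation

variable {K : Rn n → ℝ≥0∞} {ν : Measure (Rn n)} {E : Set (Rn n)} {Λ : ℝ≥0}

theorem measurable_perimeter_superlevel (hK : Measurable K) {u : Rn n → ℝ} (hu : Measurable u) :
    Measurable fun t : ℝ => perimeter K {x | t < u x} :=
  ((measurable_variation_integrand_superlevel hK hu).comp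
    (f := fun p : (ℝ × Rn n) × Rn n => ((p.1.2, p.1.1), p.2))
    (by fun_prop)).lintegral_prod_right'.lintegral_prod_right'.const_mul _

theorem functionalEnergy_congr_ae (hν : AdmissibleWeight ν) {f g u v : Rn n → ℝ}
    (hf : f =ᵐ[volume] g) (hu : u =ᵐ[volume] v) :
    functionalEnergy K ν f Λ u = functionalEnergy K ν g Λ v := by
  unfold functionalEnergy
  rw [variation_congr_ae K hu]
  congr 2
  refine lintegral_congr_ae ?_
  filter_upwards [hν.absolutelyContinuous.ae_le hf, hν.absolutelyContinuous.ae_le hu]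
    with x h1 h2
  rw [h1, h2]

theorem functionalEnergy_chi (hν : AdmissibleWeight ν) {U : Set (Rn n)}
    (hE : NullMeasurableSet E volume) (hU : NullMeasurableSet U volume) :
    functionalEnergy K ν (chi E) Λ (chi U) = geometricEnergy K ν E Λ U := by
  unfold functionalEnergy geometricEnergy perimeter
  rw [lintegral_abs_chi_sub ((hE.symmDiff hU).mono_ac hν.absolutelyContinuous)]

theorem measurable_fidelity_superlevel [SFinite ν] {f u : Rn n → ℝ} (hf : Measurable f)
    (hu : Measurable u) : Measurable fun t : ℝ =>
      ∫⁻ x, ENNReal.ofReal |chi {x | t < u x} x - chi {x | t < f x} x| ∂ν :=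
  ((measurable_chi_superlevel hu).sub
      (measurable_chi_superlevel hf)).abs.ennreal_ofReal.lintegral_prod_right'

theorem measurable_functionalEnergy_superlevel [SFinite ν] (hK : Measurable K)
    {f u : Rn n → ℝ} (hf : Measurable f) (hu : Measurable u) : Measurable fun t : ℝ =>
      functionalEnergy K ν (chi {x | t < f x}) Λ (chi {x | t < u x}) :=
  (measurable_perimeter_superlevel hK hu).add
    ((measurable_fidelity_superlevel hf hu).const_mul _)

/-- Coarea formula for the functional energy. -/
theorem functionalEnergy_eq_lintegral [SFinite ν] (hK : Measurable K)
    {f u : Rn n → ℝ} (hf : Measurable f) (hu : Measurable u) :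
    functionalEnergy K ν f Λ u
      = ∫⁻ t : ℝ, functionalEnergy K ν (chi {x | t < f x}) Λ (chi {x | t < u x}) := by
  simp only [functionalEnergy, ← perimeter.eq_1]
  rw [lintegral_add_left (measurable_perimeter_superlevel hK hu),
    lintegral_const_mul _ (measurable_fidelity_superlevel hf hu),
    variation_eq_lintegral_perimeter hK hu, lintegral_abs_sub_eq_lintegral_chi hu hf]

theorem superlevel_chi_of_mem_Ico (E : Set (Rn n)) {t : ℝ} (ht : t ∈ Ico (0 : ℝ) 1) :
    {x | t < chi E x} = E := by
  ext x
  by_cases hx : x ∈ E <;> simp [chi, hx, ht.1, ht.2]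

theorem superlevel_chi_of_neg (E : Set (Rn n)) {t : ℝ} (ht : t < 0) :
    {x | t < chi E x} = univ := by
  ext x
  by_cases hx : x ∈ E <;> simp [chi, hx, ht, ht.trans one_pos]

theorem superlevel_chi_of_one_le (E : Set (Rn n)) {t : ℝ} (ht : 1 ≤ t) :
    {x | t < chi E x} = ∅ := by
  ext x
  by_cases hx : x ∈ E <;> simp [chi, hx, ht, (zero_lt_one' ℝ).le.trans ht]

theorem indicator_le_functionalEnergy_superlevel (hK : Measurable K) (hν : AdmissibleWeight ν)
    (hE : Convex ℝ E) (hEfin : volume E < ∞) (hΛ : 0 < Λ) (hΛh : Λ ≤ cheegerConst K ν E)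
    {u : Rn n → ℝ} (hu : Measurable u) (t : ℝ) :
    (Ico (0 : ℝ) 1).indicator (fun _ => Λ * ν E) t
      ≤ functionalEnergy K ν (chi {x | t < chi E x}) Λ (chi {x | t < u x}) := by
  refine indicator_apply_le' (fun ht => ?_) fun _ => zero_le
  have hU : NullMeasurableSet {x | t < u x} volume :=
    (measurableSet_lt measurable_const hu).nullMeasurableSet
  rw [superlevel_chi_of_mem_Ico E ht, functionalEnergy_chi hν (hE.nullMeasurableSet volume) hU]
  exact mul_measure_le_geometricEnergy hK hν hE hEfin hΛ hΛh hU

theorem lintegral_indicator_Ico_const (a : ℝ≥0∞) :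
    ∫⁻ t : ℝ, (Ico (0 : ℝ) 1).indicator (fun _ => a) t = a := by
  rw [lintegral_indicator_const measurableSet_Ico]
  simp

theorem mul_measure_le_functionalEnergy (hK : Measurable K) (hν : AdmissibleWeight ν)
    (hE : Convex ℝ E) (hEfin : volume E < ∞) (hEm : MeasurableSet E) (hΛ : 0 < Λ)
    (hΛh : Λ ≤ cheegerConst K ν E) {u : Rn n → ℝ} (hu : Measurable u) :
    Λ * ν E ≤ functionalEnergy K ν (chi E) Λ u := by
  have := hν.sfinite
  rw [functionalEnergy_eq_lintegral hK (measurable_chi hEm) hu,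
    ← lintegral_indicator_Ico_const (Λ * ν E)]
  exact lintegral_mono (indicator_le_functionalEnergy_superlevel hK hν hE hEfin hΛ hΛh hu)

theorem functionalEnergy_le_of_superlevel_mem (hK : Measurable K) (hν : AdmissibleWeight ν)
    (hE : Convex ℝ E) (hEfin : volume E < ∞) (hEm : MeasurableSet E) (hΛ : 0 < Λ)
    (hΛh : Λ ≤ cheegerConst K ν E) {u : Rn n → ℝ} (hu : Measurable u)
    (hu01 : ∀ᵐ x, u x ∈ Icc (0 : ℝ) 1)
    (hsol : ∀ t ∈ Ico (0 : ℝ) 1, {x | t < u x} ∈ geometricSol K ν E Λ) :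
    functionalEnergy K ν (chi E) Λ u ≤ Λ * ν E := by
  have := hν.sfinite
  rw [functionalEnergy_eq_lintegral hK (measurable_chi hEm) hu,
    ← lintegral_indicator_Ico_const (Λ * ν E)]
  have hself : ∀ f : Rn n → ℝ, functionalEnergy K ν f Λ f = variation K f := fun f => by
    simp [functionalEnergy]
  refine lintegral_mono fun t => ?_
  rcases lt_or_ge t 0 with h0 | h0
  -- Outside `[0,1)` the superlevel sets of `u` and `χ_E` agree a.e. (everything or nothing), so
  -- these levels cost nothing.
  · have hu' : {x | t < u x} =ᵐ[volume] (univ : Set (Rn n)) := by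
      rw [Filter.eventuallyEq_univ]
      filter_upwards [hu01] with x hx
      exact h0.trans_le hx.1
    rw [superlevel_chi_of_neg E h0, functionalEnergy_congr_ae hν (ae_eq_refl _)
      (chi_congr_ae hu'), hself]
    simp [variation, chi]
  rcases lt_or_ge t 1 with h1 | h1
  · have ht : t ∈ Ico (0 : ℝ) 1 := ⟨h0, h1⟩
    have h2 := (mem_geometricSol_iff_energy_le hK hν hE hEfin hΛ hΛh).1 (hsol t ht)
    rw [superlevel_chi_of_mem_Ico E ht, functionalEnergy_chi hν hEm.nullMeasurableSet h2.1,
      indicator_of_mem ht]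
    exact h2.2
  · have hu' : {x | t < u x} =ᵐ[volume] (∅ : Set (Rn n)) := by
      rw [ae_eq_empty, measure_eq_zero_iff_ae_notMem]
      filter_upwards [hu01] with x hx
      exact (hx.2.trans h1).not_gt
    rw [superlevel_chi_of_one_le E h1, functionalEnergy_congr_ae hν (ae_eq_refl _)
      (chi_congr_ae hu'), hself]
    simp [variation, chi]

theorem measure_symmDiff_eq_zero_of_functionalEnergy_eq_zero (hν : AdmissibleWeight ν)
    (hΛ : 0 < Λ) {U V : Set (Rn n)} (hU : NullMeasurableSet U volume)
    (hV : NullMeasurableSet V volume)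
    (h : functionalEnergy K ν (chi U) Λ (chi V) = 0) : volume (U ∆ V) = 0 := by
  rw [functionalEnergy_chi hν hU hV, geometricEnergy, add_eq_zero, mul_eq_zero,
    hν.measure_eq_zero_iff] at h
  exact h.2.resolve_left (by exact_mod_cast hΛ.ne')

theorem superlevel_mem_of_functionalEnergy_le (hK : Measurable K) (hν : AdmissibleWeight ν)
    (hE : Convex ℝ E) (hEfin : volume E < ∞) (hEm : MeasurableSet E) (hΛ : 0 < Λ)
    (hΛh : Λ ≤ cheegerConst K ν E) {u : Rn n → ℝ} (hu : Measurable u)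
    (hle : functionalEnergy K ν (chi E) Λ u ≤ Λ * ν E) :
    (∀ᵐ x, u x ∈ Icc (0 : ℝ) 1) ∧
      ∀ t ∈ Ico (0 : ℝ) 1, {x | t < u x} ∈ geometricSol K ν E Λ := by
  have := hν.sfinite
  have hlev : ∀ t : ℝ, MeasurableSet {x | t < u x} := fun t =>
    measurableSet_lt measurable_const hu
  -- The levelwise lower bound has integral `Λ ν(E) < ∞`, no less than the energy of `u`, so it is
  -- attained at almost every level. Such levels are dense.
  have hae := ae_eq_of_ae_le_of_lintegral_le
    (ae_of_all volume (indicator_le_functionalEnergy_superlevel hK hν hE hEfin hΛ hΛh hu))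
    (by
      rw [lintegral_indicator_Ico_const]
      exact (ENNReal.mul_lt_top (by simp) (hν.measure_lt_top_iff.2 hEfin)).ne)
    (measurable_functionalEnergy_superlevel hK (measurable_chi hEm) hu).aemeasurable
    (by
      rw [lintegral_indicator_Ico_const,
        ← functionalEnergy_eq_lintegral hK (measurable_chi hEm) hu]
      exact hle)
  have hdense := Measure.dense_of_ae hae
  set D : Set ℝ := {t | (Ico (0 : ℝ) 1).indicator (fun _ => Λ * ν E) t
    = functionalEnergy K ν (chi {x | t < chi E x}) Λ (chi {x | t < u x})} with hD
  have hlo : ∀ᵐ x, 0 ≤ u x := by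
    obtain ⟨s, -, hs, hlim⟩ := hdense.exists_seq_strictMono_tendsto 0
    have h1 : ∀ k, ∀ᵐ x, s k < u x := by
      intro k
      have hk := (hs k).2
      rw [hD, mem_ofPred_eq, indicator_of_notMem (fun h => h.1.not_gt (hs k).1),
        superlevel_chi_of_neg E (hs k).1] at hk
      have := measure_symmDiff_eq_zero_of_functionalEnergy_eq_zero hν hΛ
        nullMeasurableSet_univ (hlev _).nullMeasurableSet hk.symm
      refine measure_mono_null (fun x hx => ?_) this
      exact Or.inl ⟨trivial, hx⟩
    filter_upwards [ae_all_iff.2 h1] with x hx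
    exact le_of_tendsto' hlim fun k => (hx k).le
  have hhi : ∀ᵐ x, u x ≤ 1 := by
    obtain ⟨s, -, hs, hlim⟩ := hdense.exists_seq_strictAnti_tendsto 1
    have h1 : ∀ k, ∀ᵐ x, ¬ s k < u x := by
      intro k
      have hk := (hs k).2
      rw [hD, mem_ofPred_eq, indicator_of_notMem (fun h => h.2.not_gt (hs k).1),
        superlevel_chi_of_one_le E (le_of_lt (hs k).1)] at hk
      have := measure_symmDiff_eq_zero_of_functionalEnergy_eq_zero hν hΛ
        nullMeasurableSet_empty (hlev _).nullMeasurableSet hk.symm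
      refine measure_mono_null (fun x hx => ?_) this
      exact Or.inr ⟨not_not.1 hx, notMem_empty x⟩
    filter_upwards [ae_all_iff.2 h1] with x hx
    exact ge_of_tendsto' hlim fun k => not_lt.1 (hx k)
  refine ⟨by filter_upwards [hlo, hhi] with x h0 h1 using ⟨h0, h1⟩, fun t ht => ?_⟩
  -- The level `t` itself may be exceptional. Optimal levels `s k` decreasing to `t` make `{u > s
  -- k}` increase to `{u > t}`, and `P_K({u > s k}) ≤ Λ ν({u > s k}) ≤ Λ ν({u > t})` passes to the
  -- limit.
  obtain ⟨s, -, hs, hlim⟩ := hdense.exists_seq_strictAnti_tendsto_of_lt ht.2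
  have hsol : ∀ k, ∃ V : Set (Rn n), {x | s k < u x} =ᵐ[volume] V ∧
      NullMeasurableSet V volume ∧ V ⊆ E ∧ perimeter K V ≤ Λ * ν V := by
    intro k
    have hIco : s k ∈ Ico (0 : ℝ) 1 := ⟨ht.1.trans (hs k).1.1.le, (hs k).1.2⟩
    have hk := (hs k).2
    rw [hD, mem_ofPred_eq, indicator_of_mem hIco, superlevel_chi_of_mem_Ico E hIco,
      functionalEnergy_chi hν hEm.nullMeasurableSet (hlev _).nullMeasurableSet] at hk
    rw [← mem_geometricSol_iff hK hν hE hEfin hΛ hΛh,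
      mem_geometricSol_iff_energy_le hK hν hE hEfin hΛ hΛh]
    exact ⟨(hlev _).nullMeasurableSet, hk.ge⟩
  choose V hUV hV hVE hP using hsol
  have hWE : {x | t < u x} ≤ᵐ[volume] E := by
    have h1 : ∀ᵐ x, ∀ k, s k < u x → x ∈ E :=
      ae_all_iff.2 fun k => (hUV k).le.trans (hVE k).eventuallyLE
    filter_upwards [h1] with x hx htx
    obtain ⟨k, hk⟩ := (hlim.eventually (gt_mem_nhds htx)).exists
    exact hx k hk
  have hWE' : {x | t < u x} =ᵐ[volume] ({x | t < u x} ∩ E : Set (Rn n)) := by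
    refine Filter.EventuallyLE.antisymm ?_ inter_subset_left.eventuallyLE
    simpa using (Filter.EventuallyLE.refl (ae volume) {x | t < u x}).inter hWE
  rw [mem_geometricSol_iff hK hν hE hEfin hΛ hΛh]
  refine ⟨{x | t < u x} ∩ E, hWE', ((hlev t).inter hEm).nullMeasurableSet,
    inter_subset_right, ?_⟩
  rw [← perimeter_congr_ae K hWE', ← measure_congr (hν.absolutelyContinuous.ae_eq hWE')]
  refine perimeter_le_of_forall_le hK (fun k => hlev (s k)) (fun x => ?_) (fun k => ?_)
  · by_cases htx : t < u x
    · filter_upwards [hlim.eventually (gt_mem_nhds htx)] with k hk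
      exact iff_of_true hk htx
    · exact Filter.Eventually.of_forall fun k =>
        iff_of_false (fun h => htx ((hs k).1.1.trans h)) htx
  · rw [perimeter_congr_ae K (hUV k)]
    refine (hP k).trans ?_
    rw [← measure_congr (hν.absolutelyContinuous.ae_eq (hUV k))]
    gcongr
    exact (hs k).1.1.le

theorem integrable_of_functionalEnergy_lt_top (hν : AdmissibleWeight ν)
    (hE : MeasurableSet E) (hEfin : volume E < ∞) (hΛ : 0 < Λ) {u : Rn n → ℝ}
    (hu : AEStronglyMeasurable u volume) (h : functionalEnergy K ν (chi E) Λ u < ∞) :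
    Integrable u volume := by
  obtain ⟨c, M, hc, -, hcν, -⟩ := hν.exists_bounds
  have hchi : Integrable (chi E) volume :=
    (integrable_indicator_iff hE).2 (integrableOn_const hEfin.ne)
  have h1 := (ENNReal.add_lt_top.1 h).2
  have h2 := ENNReal.lt_top_of_mul_ne_top_right h1.ne (by exact_mod_cast hΛ.ne')
  have h3 := (lintegral_mono' hcν le_rfl).trans_lt h2
  rw [lintegral_smul_measure, ENNReal.smul_def, smul_eq_mul] at h3
  have h4 := ENNReal.lt_top_of_mul_ne_top_right h3.ne (by exact_mod_cast hc.ne')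
  have h5 : Integrable (fun x => u x - chi E x) volume := by
    refine ⟨hu.sub hchi.aestronglyMeasurable, ?_⟩
    rw [hasFiniteIntegral_iff_norm]
    exact h4
  refine (h5.add hchi).congr (ae_of_all _ fun x => ?_)
  simp

theorem mem_functionalSol_iff (hK : Measurable K) (hν : AdmissibleWeight ν)
    (hE : Convex ℝ E) (hEfin : volume E < ∞) (hΛ : 0 < Λ) (hΛh : Λ ≤ cheegerConst K ν E)
    {u : Rn n → ℝ} :
    u ∈ functionalSol K ν (chi E) Λ ↔
      u ∈ BVUnit K ∧ ∀ t ∈ Ico (0 : ℝ) 1, {x | t < u x} ∈ geometricSol K ν E Λ := by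
  have hae := convex_interior_ae_eq hE
  set E' := interior E with hE'
  have hEm' : MeasurableSet E' := isOpen_interior.measurableSet
  have hνE : ν E' = ν E := measure_congr (hν.absolutelyContinuous.ae_eq hae)
  have hEfin' : volume E' < ∞ := by rwa [measure_congr hae]
  have hgeo : ∀ U, geometricEnergy K ν E' Λ U = geometricEnergy K ν E Λ U := fun U => by
    unfold geometricEnergy
    rw [measure_congr (hν.absolutelyContinuous.ae_eq (hae.symmDiff (ae_eq_refl U)))]
  have hsol : geometricSol K ν E' Λ = geometricSol K ν E Λ := by
    simp only [geometricSol, hgeo]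
  -- Coarea is used with a Borel datum, hence the passage to `interior E`. Fewer competitors can
  -- only raise the Cheeger constant.
  have hΛh' : Λ ≤ cheegerConst K ν E' :=
    hΛh.trans (sInf_le_sInf (image_mono fun F hF => ⟨hF.1, hF.2.1.trans interior_subset, hF.2.2⟩))
  have hsol_congr : ∀ {U V : Set (Rn n)}, U =ᵐ[volume] V → U ∈ geometricSol K ν E Λ →
      V ∈ geometricSol K ν E Λ := by
    intro U V hUV hU
    rw [mem_geometricSol_iff hK hν hE hEfin hΛ hΛh] at hU ⊢
    obtain ⟨W, hW, h⟩ := hU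
    exact ⟨W, hUV.symm.trans hW, h⟩
  have hlev : ∀ {u v : Rn n → ℝ}, u =ᵐ[volume] v → ∀ t : ℝ,
      {x | t < u x} =ᵐ[volume] {x | t < v x} := by
    intro u v huv t
    filter_upwards [huv] with x hx
    change (t < u x) = (t < v x)
    rw [hx]
  constructor
  · rintro ⟨hloc, hfin, hmin⟩
    have hum := hloc.aestronglyMeasurable
    obtain ⟨v, hv, huv⟩ := hum.aemeasurable
    have hmin0 := hmin 0 (locallyIntegrable_const 0)
    have h0 : functionalEnergy K ν (chi E) Λ 0 = Λ * ν E := by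
      have : (0 : Rn n → ℝ) = chi ∅ := by ext; simp [chi]
      rw [this, functionalEnergy_chi hν (hE.nullMeasurableSet volume) nullMeasurableSet_empty,
        geometricEnergy_empty]
    rw [h0, functionalEnergy_congr_ae hν (chi_congr_ae hae.symm) huv, ← hνE] at hmin0
    obtain ⟨h1, h2⟩ := superlevel_mem_of_functionalEnergy_le hK hν hE.interior hEfin' hEm' hΛ
      hΛh' hv hmin0
    rw [functionalEnergy_congr_ae hν (chi_congr_ae hae.symm) (ae_eq_refl u)] at hfin
    refine ⟨⟨integrable_of_functionalEnergy_lt_top hν hEm' hEfin' hΛ hum hfin,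
      (ENNReal.add_lt_top.1 hfin).1, ?_⟩, fun t ht => ?_⟩
    · filter_upwards [h1, huv] with x hx hx'
      rwa [hx']
    · exact hsol_congr (hlev huv.symm t) (hsol ▸ h2 t ht)
  · rintro ⟨⟨hint, -, h01⟩, hlevels⟩
    obtain ⟨v, hv, huv⟩ := hint.aestronglyMeasurable.aemeasurable
    have h1 : functionalEnergy K ν (chi E) Λ u ≤ Λ * ν E := by
      rw [functionalEnergy_congr_ae hν (chi_congr_ae hae.symm) huv, ← hνE]
      refine functionalEnergy_le_of_superlevel_mem hK hν hE.interior hEfin' hEm' hΛ hΛh' hv ?_ ?_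
      · filter_upwards [h01, huv] with x hx hx'
        rwa [← hx']
      · intro t ht
        rw [hsol]
        exact hsol_congr (hlev huv t) (hlevels t ht)
    refine ⟨hint.locallyIntegrable, h1.trans_lt
      (ENNReal.mul_lt_top (by simp) (hν.measure_lt_top_iff.2 hEfin)), fun w hw => h1.trans ?_⟩
    obtain ⟨w', hw', hww'⟩ := hw.aestronglyMeasurable.aemeasurable
    rw [functionalEnergy_congr_ae hν (chi_congr_ae hae.symm) hww', ← hνE]
    exact mul_measure_le_functionalEnergy hK hν hE.interior hEfin' hEm' hΛ hΛh' hw'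

end Relaxation

end NonlocalBV

open NonlocalBV
theorem mainTheorem12 (n : ℕ) (K : Rn n → ℝ≥0∞) (q : ℝ) (ν : Measure (Rn n)) (E : Set (Rn n))
    (hK : IsKernel K) (hRad : Radial K) (hNts : NotTooSingular K) (hNint : NotIntegrable K)
    (hq : 1 ≤ q) (hqn : q < n + 1) (hDec : DecreasingExp q K) (hDou : Doubling ∞ K)
    (hν : AdmissibleWeight ν)
    (hEb : Bornology.IsBounded E) (hEc : Convex ℝ E) (hEi : (interior E).Nonempty) :
    -- (i)
    (cheegerConst K ν E
        = sSup ((fun Λ : ℝ≥0 => (Λ : ℝ≥0∞)) '' {Λ | 0 < Λ ∧ ∅ ∈ geometricSol K ν E Λ}) ∧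
      0 < cheegerConst K ν E ∧ cheegerConst K ν E < ∞) ∧
    -- (ii)
    (∀ Λ : ℝ≥0, 0 < Λ → (Λ : ℝ≥0∞) < cheegerConst K ν E →
      geometricSol K ν E Λ = upToNull {∅}) ∧
    -- (iii)
    (∀ Λ : ℝ≥0, (Λ : ℝ≥0∞) = cheegerConst K ν E →
      geometricSol K ν E Λ = upToNull (cheegerSets K ν E ∪ {∅}) ∧
      functionalSol K ν (chi E) Λ
        = {u | u ∈ BVUnit K ∧
            ∀ t ∈ Ico (0 : ℝ) 1, {x | t < u x} ∈ upToNull (cheegerSets K ν E ∪ {∅})}) ∧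
    -- (iv)
    (∀ Λ : ℝ≥0, cheegerConst K ν E < (Λ : ℝ≥0∞) → Calibrable K ν E →
      geometricSol K ν E Λ = upToNull {E}) := by
  -- For `n = 0` no `q` satisfies `1 ≤ q < n + 1`.
  have : NeZero n := ⟨by
    rintro rfl
    norm_num at hqn
    linarith⟩
  have hEfin : volume E < ∞ := hEb.measure_lt_top
  have hpos : 0 < cheegerConst K ν E :=
    cheegerConst_pos hK.1 (fun x hx => kernel_ne_zero hK hDec hDou hx) hν hEb
  have htop : cheegerConst K ν E < ∞ := cheegerConst_lt_top hK.1 hNts hν hEi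
  refine ⟨⟨?_, hpos, htop⟩,
    fun Λ hΛ hΛh => geometricSol_of_lt_cheegerConst hK.1 hν hEc hEfin hΛ hΛh, fun Λ hΛh => ?_,
    fun Λ hΛh hcal => geometricSol_of_cheegerConst_lt hK.1 hν hEc hEfin hΛh hcal⟩
  · lift cheegerConst K ν E to ℝ≥0 using htop.ne with h hh
    -- The supremum is attained, at `Λ = h` itself.
    refine le_antisymm (le_sSup (mem_image_of_mem _ ?_)) (sSup_le ?_)
    · have h0 : 0 < h := by exact_mod_cast hpos
      exact ⟨h0, empty_mem_geometricSol hK.1 hν hEc hEfin h0 hh.le⟩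
    · rintro _ ⟨Λ, ⟨-, hΛ⟩, rfl⟩
      exact (le_cheegerConst_of_empty_mem_geometricSol hν hEfin hΛ).trans_eq hh.symm
  · have hΛ : 0 < Λ := by
      rw [← hΛh] at hpos
      exact_mod_cast hpos
    have hgeo := geometricSol_of_eq_cheegerConst hK.1 hν hEc hEfin hΛ hΛh
    refine ⟨hgeo, ?_⟩
    ext u
    rw [mem_functionalSol_iff hK.1 hν hEc hEfin hΛ hΛh.le, hgeo]
    rfl
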